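/- For positive integers $n,m$ let $T_{n,m}=\mathbb Z/n\mathbb Z\times\mathbb Z/m\mathbb Z$, and let $\phi\colon T_{n,m}\to T_{n,m}$ be the random map such that, independently for the $nm$ vertices, $\phi(x,y)$ equals $(x+1,y)$ or $(x,y+1)$ with probability $\tfrac12$ each. A cycle is a periodic orbit of $\phi$, and its length is the number of its vertices (equivalently, of its edges). Let $$\frac mn=a_0+\cfrac1{a_1+\cfrac1{a_2+\cdots+\cfrac1{a_L}}}$$ be the (canonical, finite) continued fraction of $m/n$, and for $0\le j\le L$ let $p_j/q_j=[a_0;a_1,\dots,a_j]$ be its $j$-th convergent in lowest terms. Theorem. Let $\epsilon>0$ and $C>1$. There is $N=N(\epsilon,C)$ such that the following holds for all integers $n\ge N$ and $m$ with $n<m<Cn$. Suppose that $k<\ell<L$ are such that $$p_k\le n^{1/3-\frac{7}{48}\epsilon}<p_{k+1},\qquad p_\ell\le n^{1/3+\frac{47}{48}\epsilon}<p_{\ell+1},$$ and that $\max\{a_{k+1},a_{\ell+1}\}<n^{\frac5{48}\epsilon}$. Then $$\mathbb P\bigl(\text{there is a cycle of length at least } n^{4/3+\epsilon}\bigr)\le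 \exp\bigl(-n^{\epsilon/7}\bigr).$$ -/

import Mathlib

open MeasureTheory

namespace QuenchedWalk

/-- The vertex set of the `n × m` torus `ℤ² / ⟨(n,0),(0,m)⟩`. -/
abbrev Torus (n m : ℕ) : Type := ZMod n × ZMod m

/-- The map driven by a configuration `ω`: the vertex `(x, y)` is sent to `(x + 1, y)` if
`ω (x, y) = true`, and to `(x, y + 1)` otherwise. -/
def step {n m : ℕ} (ω : Torus n m → Bool) (v : Torus n m) : Torus n m :=
  if ω v then (v.1 + 1, v.2) else (v.1, v.2 + 1)

/-- The law of a fair coin. -/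
noncomputable def fairCoin : Measure Bool := (PMF.uniformOfFintype Bool).toMeasure

/-- The law of the quenched random walk: independent fair coins at all vertices of the torus. -/
noncomputable def law (n m : ℕ) [NeZero n] [NeZero m] : Measure (Torus n m → Bool) :=
  Measure.pi fun _ => fairCoin

/-- The event that the quenched random walk has a cycle (periodic orbit) with at least `L` vertices,
equivalently edges. -/
def longCycle (n m : ℕ) (L : ℝ) : Set (Torus n m → Bool) :=
  {ω | ∃ v ∈ Function.periodicPts (step ω), L ≤ (Function.minimalPeriod (step ω) v : ℝ)}

/-- The numerator `p_j` of the `j`-th convergent `[a_0; a_1, …, a_j]` of `m / n`. (Mathlib's sequence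
is constant after the last convergent, so `p_j < p_{j+1}` forces the `(j+1)`-st one to exist.) -/
noncomputable def convNum (n m j : ℕ) : ℝ :=
  (GenContFract.of ((m : ℝ) / (n : ℝ))).nums j

/-- `a` is the partial quotient `a_{j+1}` of the continued fraction `[a_0; a_1, …, a_l]` of `m / n`;
in particular `j + 1 ≤ l`. (Mathlib keeps `a_0` apart, so its `j`-th entry is `a_{j+1}`.) -/
def IsPartialQuotientSucc (n m j : ℕ) (a : ℝ) : Prop :=
  (GenContFract.of ((m : ℝ) / (n : ℝ))).partDens.get? j = some a

end QuenchedWalk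

namespace QuenchedWalk

/-! A cycle of length at least `T + 1` contains a walk whose vertices at times `0, …, T` are
distinct. From a given vertex, a given word of this kind is followed with probability at most `2⁻ᵀ`.
Since the number `n m` of starting vertices is only polynomial, it suffices that avoiding words form
a tiny fraction of the `2 ^ T` words.

Lift the walk to `ℤ²`. An avoiding walk misses every translate of its own past by a lattice vector
`(P n, Q m)`. All paths advance one antidiagonal per step, so two of them cannot swap sides without
meeting: each translate is a wall. Let `p/q`, `p'/q'` be consecutive convergents of `m/n`, and put
`τ = p n + q m`, `τ' = p' n + q' m`. By Hoeffding, the initial piece of the walk is very likely to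
make `p n ± R` horizontal moves in every window of length `τ`, and likewise for `τ'`. Its translates
then form a two-sided family of walls with gaps at most `R` (`confinement`).

Hence, given the past, the horizontal count after `B = 4 (R + 1) ^ 2` further steps takes at most `R
+ 1` values, which allows at most half of the words (`two_mul_choose_middle_le`). After `J` blocks
the fraction is at most `2⁻ᴶ` (`card_goodWords_le`).

Sizes: `|p n - q m|` and `|p' n - q' m|` are at most `n / q'` (`exists_convergents`), hence at most
`n ^ (2/3 + ε/4)`, which is about `R`. The bound on the partial quotient keeps `p'`, and so `τ` and
`τ'`, at orders at most `n ^ (1/3)` and `n ^ (4/3)`. With `J` about `n ^ (ε/4)`, all blocks fit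
below `n ^ (4/3 + ε)`. -/

/-- The number of horizontal moves among the first `t` letters of `x`. -/
def horiz (x : ℕ → Bool) (t : ℕ) : ℕ := ∑ i ∈ Finset.range t, (x i).toNat

/-- The walk driven by `x` visits pairwise distinct vertices of the torus up to time `T`. -/
def Avoids (n m : ℕ) (x : ℕ → Bool) (T : ℕ) : Prop :=
  ∀ s t, s < t → t ≤ T → ¬ ((n : ℤ) ∣ (horiz x t : ℤ) - horiz x s ∧
    (m : ℤ) ∣ ((t : ℤ) - horiz x t) - ((s : ℤ) - horiz x s))

/-- Over every time window of length `τ` before time `M`, the number of horizontal moves is within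
`R` of `c`. -/
def Balanced (x : ℕ → Bool) (M τ : ℕ) (c R : ℤ) : Prop :=
  ∀ s, s + τ ≤ M → |(horiz x (s + τ) : ℤ) - horiz x s - c| ≤ R

theorem horiz_succ (x : ℕ → Bool) (t : ℕ) : horiz x (t + 1) = horiz x t + (x t).toNat :=
  Finset.sum_range_succ _ _

theorem horiz_le (x : ℕ → Bool) (t : ℕ) : horiz x t ≤ t := by
  induction t with
  | zero => simp [horiz]
  | succ t ih => rw [horiz_succ]; have := Bool.toNat_le (x t); omega

theorem horiz_congr {x y : ℕ → Bool} {t : ℕ} (h : ∀ i < t, x i = y i) : horiz x t = horiz y t :=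
  Finset.sum_congr rfl fun i hi => by rw [h i (Finset.mem_range.1 hi)]

theorem horiz_add (x : ℕ → Bool) (s t : ℕ) :
    horiz x (s + t) = horiz x s + horiz (fun i => x (s + i)) t :=
  Finset.sum_range_add _ _ _

/-! ### Confinement between translates of the past -/

/-- A two-sided integer sequence taking values on both sides of `z` crosses `z` between two
consecutive indices. -/
theorem exists_crossing (E : ℤ → ℤ) (z : ℤ) {i j : ℤ} (hi : E i ≤ z) (hj : z ≤ E j) :
    ∃ k, (E k ≤ z ∧ z ≤ E (k + 1)) ∨ (E (k + 1) ≤ z ∧ z ≤ E k) := by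
  by_contra! H
  -- Without a crossing, lying at or below `z` is invariant under shifts in both directions.
  have hstep : ∀ k, E k ≤ z ↔ E (k + 1) ≤ z := by
    intro k
    have h1 := (H k).1
    have h2 := (H k).2
    constructor
    · intro h
      exact (h1 h).le
    · intro h
      exact (h2 h).le
  have hall : ∀ d : ℤ, E (i + d) ≤ z := by
    intro d
    induction d using Int.induction_on with
    | zero => simpa using hi
    | succ d ih => rw [← add_assoc]; exact (hstep _).1 ih
    | pred d ih => refine (hstep _).2 ?_; convert ih using 2; ring
  have h1 := hall (j - i)
  have h2 := hall (j - i + 1)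
  rw [add_sub_cancel] at h1
  rw [← add_assoc, add_sub_cancel] at h2
  have := (H j).2 h2
  omega

/-- An integer sequence with steps at most one that never vanishes keeps its sign. -/
theorem nonneg_of_steps (g : ℕ → ℤ) (B : ℕ) (hstep : ∀ u, |g (u + 1) - g u| ≤ 1)
    (h0 : ∀ u ≤ B, g u ≠ 0) (hg : 0 ≤ g 0) : ∀ u ≤ B, 0 ≤ g u := by
  intro u
  induction u with
  | zero => intro _; exact hg
  | succ u ih =>
    intro hu
    have h1 := ih (by omega)
    have h2 := h0 u (by omega)
    have h3 := abs_le.1 (hstep u)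
    omega

/-- Two independent lattice vectors give, at every time, lattice translates of the initial piece of
the walk on both sides of the current position; two neighbouring ones confine the walk. -/
theorem confinement {n m p q p' q' τ τ' B M t₀ : ℕ} {R : ℤ} (hn : 0 < n) (hm : 0 < m)
    (hτ : τ = p * n + q * m) (hτ' : τ' = p' * n + q' * m)
    (hdet : (p : ℤ) * q' ≠ q * p') (hM : τ + τ' + B ≤ M) (ht₀ : M ≤ t₀)
    (x : ℕ → Bool) (hb : Balanced x M τ (p * n) R) (hb' : Balanced x M τ' (p' * n) R) :
    ∃ α : ℤ, ∀ y : ℕ → Bool, (∀ i < t₀, y i = x i) → Avoids n m y (t₀ + B) →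
      α ≤ (horiz y (t₀ + B) : ℤ) - horiz y t₀ ∧
        (horiz y (t₀ + B) : ℤ) - horiz y t₀ ≤ α + R := by
  set N : ℤ := (τ : ℤ) + τ' with hN
  have hNpos : 0 < N := by
    by_contra h
    have h1 : τ = 0 := by omega
    have h2 : τ' = 0 := by omega
    rw [h1] at hτ
    rw [h2] at hτ'
    have h3 : p = 0 := by
      have : p * n = 0 := by omega
      rcases Nat.mul_eq_zero.1 this with h | h <;> omega
    have h4 : p' = 0 := by
      have : p' * n = 0 := by omega
      rcases Nat.mul_eq_zero.1 this with h | h <;> omega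
    apply hdet
    simp [h3, h4]
  -- The `i`-th wall is the past shifted by `(P i * n, Q i * m)`; at time `t₀` it shows the past at
  -- time `r i`. Reduction modulo `τ + τ'` keeps that time in the balanced initial piece.
  let r : ℤ → ℤ := fun i => ((t₀ : ℤ) - i * τ) % N
  let c : ℤ → ℤ := fun i => ((t₀ : ℤ) - i * τ) / N
  have hrc : ∀ i, r i + N * c i = t₀ - i * τ := fun i => Int.emod_add_mul_ediv _ _
  have hr0 : ∀ i, 0 ≤ r i := fun i => Int.emod_nonneg _ hNpos.ne'
  have hrN : ∀ i, r i < N := fun i => Int.emod_lt_of_pos _ hNpos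
  let P : ℤ → ℤ := fun i => i * p + c i * (p + p')
  let Q : ℤ → ℤ := fun i => i * q + c i * (q + q')
  have htime : ∀ i, P i * n + Q i * m = t₀ - r i := by
    intro i
    have h := hrc i
    have h1 : (τ : ℤ) = p * n + q * m := by exact_mod_cast hτ
    have h2 : (τ' : ℤ) = p' * n + q' * m := by exact_mod_cast hτ'
    have : (t₀ : ℤ) - r i = i * τ + c i * (τ + τ') := by rw [← hN]; linarith
    rw [this, h1, h2]
    simp only [P, Q]
    ring
  let s : ℤ → ℕ := fun i => (r i).toNat
  have hs : ∀ i, (s i : ℤ) = r i := fun i => Int.toNat_of_nonneg (hr0 i)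
  have hsM : ∀ i, s i + B ≤ M := by
    intro i
    have := hs i
    have := hrN i
    omega
  have hst : ∀ i, s i < t₀ := by
    intro i
    have := hs i
    have := hrN i
    omega
  let f : ℤ → ℕ → ℤ := fun i u => (horiz x (s i + u) : ℤ) + P i * n
  -- consecutive translates are close
  have hcase : ∀ i, (r (i + 1) + τ = r i ∧ P (i + 1) = P i + p) ∨
      (r (i + 1) = r i + τ' ∧ P (i + 1) = P i - p') := by
    intro i
    have h1 := hrc i
    have h2 := hrc (i + 1)
    have h3 : r (i + 1) - r i + N * (c (i + 1) - c i) = -τ := by linarith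
    have h4 := hr0 i
    have h5 := hrN i
    have h6 := hr0 (i + 1)
    have h7 := hrN (i + 1)
    have h8 : c (i + 1) - c i < 1 := by
      by_contra h
      have : N * 1 ≤ N * (c (i + 1) - c i) := mul_le_mul_of_nonneg_left (by omega) hNpos.le
      omega
    have h9 : -2 < c (i + 1) - c i := by
      by_contra h
      have : N * (c (i + 1) - c i) ≤ N * (-2) := mul_le_mul_of_nonneg_left (by omega) hNpos.le
      omega
    have h10 : c (i + 1) - c i = 0 ∨ c (i + 1) - c i = -1 := by omega
    rcases h10 with h | h
    · left
      rw [h] at h3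
      refine ⟨by linarith, ?_⟩
      have : c (i + 1) = c i := by omega
      simp only [P, this]
      ring
    · right
      rw [h] at h3
      refine ⟨by linarith, ?_⟩
      have : c (i + 1) = c i - 1 := by omega
      simp only [P, this]
      ring
  have hgap : ∀ i, |f (i + 1) B - f i B| ≤ R := by
    intro i
    rcases hcase i with ⟨h1, h2⟩ | ⟨h1, h2⟩
    · have h3 : s i + B = (s (i + 1) + B) + τ := by
        have := hs i
        have := hs (i + 1)
        omega
      have h4 := hb (s (i + 1) + B) (by rw [← h3]; exact hsM i)
      simp only [f]
      rw [h3, h2, abs_sub_comm]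
      convert h4 using 2
      ring
    · have h3 : s (i + 1) + B = (s i + B) + τ' := by
        have := hs i
        have := hs (i + 1)
        omega
      have h4 := hb' (s i + B) (by rw [← h3]; exact hsM (i + 1))
      simp only [f]
      rw [h3, h2]
      convert h4 using 2
      ring
  -- translates are found arbitrarily far on both sides
  set Δ : ℤ := p * τ' - p' * τ with hΔ
  have hΔ0 : Δ ≠ 0 := by
    have : Δ = m * (p * q' - q * p') := by
      rw [hΔ, hτ, hτ']
      push_cast
      ring
    rw [this]
    exact mul_ne_zero (by exact_mod_cast hm.ne') (sub_ne_zero.2 hdet)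
  have hPN : ∀ i, N * P i = i * Δ + (t₀ - r i) * (p + p') := by
    intro i
    have h := hrc i
    have : N * P i = N * (i * p) + (N * c i) * (p + p') := by simp only [P]; ring
    rw [this, show N * c i = t₀ - i * τ - r i by linarith, hΔ, hN]
    ring
  have hPbound : ∀ i, i * Δ ≤ N * P i ∧ N * P i ≤ i * Δ + t₀ * (p + p') := by
    intro i
    have h1 := hs i
    have h2 := hst i
    have h3 : (0 : ℤ) ≤ t₀ - r i := by omega
    have h4 : (t₀ : ℤ) - r i ≤ t₀ := by have := hr0 i; omega
    have h5 : (0 : ℤ) ≤ (p : ℤ) + p' := by positivity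
    rw [hPN]
    constructor
    · nlinarith
    · nlinarith
  have hfar : ∀ Z : ℕ, ∃ i, (Z : ℤ) ≤ P i := by
    intro Z
    -- The factor `Δ` in the witness makes the drift a multiple of `Δ * Δ ≥ 1`, whatever the sign of
    -- `Δ`.
    refine ⟨Δ * (N * Z), ?_⟩
    have h1 := (hPbound (Δ * (N * Z))).1
    have h2 : 1 ≤ Δ * Δ := by
      have := mul_self_pos.2 hΔ0
      omega
    have h3 : (0 : ℤ) ≤ N * Z := by positivity
    have h4 : N * Z ≤ Δ * (N * Z) * Δ := by nlinarith
    exact le_of_mul_le_mul_left (h4.trans h1) hNpos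
  have hfar' : ∀ Z : ℕ, ∃ i, P i ≤ -(Z : ℤ) := by
    intro Z
    set Y : ℤ := N * Z + t₀ * (p + p') with hY
    refine ⟨-(Δ * Y), ?_⟩
    have h1 := (hPbound (-(Δ * Y))).2
    have h2 : 1 ≤ Δ * Δ := by
      have := mul_self_pos.2 hΔ0
      omega
    have h3 : (0 : ℤ) ≤ Y := by positivity
    have h4 : -(Δ * Y) * Δ ≤ -Y := by nlinarith
    refine le_of_mul_le_mul_left ?_ hNpos
    calc N * P (-(Δ * Y)) ≤ -Y + t₀ * (p + p') := by linarith
      _ = N * -(Z : ℤ) := by rw [hY]; ring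
  have hn1 : (1 : ℤ) ≤ n := by exact_mod_cast hn
  obtain ⟨i₁, hi₁⟩ := hfar' t₀
  obtain ⟨i₂, hi₂⟩ := hfar t₀
  have hlow : f i₁ 0 ≤ horiz x t₀ := by
    have h1 := horiz_le x (s i₁ + 0)
    have h2 := hst i₁
    have h3 : P i₁ * n ≤ -(t₀ : ℤ) := by nlinarith
    simp only [f]
    omega
  have hhigh : (horiz x t₀ : ℤ) ≤ f i₂ 0 := by
    have h1 := horiz_le x t₀
    have h3 : (t₀ : ℤ) ≤ P i₂ * n := by nlinarith
    simp only [f]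
    omega
  obtain ⟨k, hk⟩ := exists_crossing (fun i => f i 0) (horiz x t₀) hlow hhigh
  -- an avoiding walk never meets a translate
  have key : ∀ y : ℕ → Bool, (∀ i < t₀, y i = x i) → Avoids n m y (t₀ + B) → ∀ i,
      (f i 0 ≤ horiz x t₀ → f i B ≤ horiz y (t₀ + B)) ∧
      (horiz x t₀ ≤ f i 0 → (horiz y (t₀ + B) : ℤ) ≤ f i B) := by
    intro y hy hav i
    have hxy : ∀ t ≤ t₀, horiz y t = horiz x t := fun t ht =>
      horiz_congr fun j hj => hy j (by omega)
    -- Signed distance from the walk to the wall: it changes by at most one per step, and a zero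
    -- would be a repeated vertex of the torus.
    let g : ℕ → ℤ := fun u => horiz y (t₀ + u) - f i u
    have hg0 : ∀ u ≤ B, g u ≠ 0 := by
      intro u hu hgu
      have h1 : (horiz y (s i + u) : ℤ) = horiz x (s i + u) := by
        rw [hxy]
        have := hsM i
        omega
      have h2 : (horiz y (t₀ + u) : ℤ) - horiz y (s i + u) = P i * n := by
        simp only [g, f] at hgu
        linarith
      refine hav (s i + u) (t₀ + u) (by have := hst i; omega) (by omega) ⟨⟨P i, by linarith⟩, ⟨Q i, ?_⟩⟩
      have h3 := htime i
      rw [← hs i] at h3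
      push_cast
      linarith
    have hgs : ∀ u, |g (u + 1) - g u| ≤ 1 := by
      intro u
      have h1 : horiz y (t₀ + (u + 1)) = _ := horiz_succ y (t₀ + u)
      have h2 : horiz x (s i + (u + 1)) = _ := horiz_succ x (s i + u)
      have h3 := Bool.toNat_le (y (t₀ + u))
      have h4 := Bool.toNat_le (x (s i + u))
      simp only [g, f]
      rw [h1, h2, abs_le]
      push_cast
      omega
    constructor
    · intro h
      have := nonneg_of_steps g B hgs hg0 (by simp only [g, add_zero, hxy t₀ le_rfl]; omega) B le_rfl
      simp only [g] at this
      linarith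
    · intro h
      have := nonneg_of_steps (fun u => - g u) B
        (fun u => by rw [neg_sub_neg, abs_sub_comm]; exact hgs u)
        (fun u hu => neg_ne_zero.2 (hg0 u hu))
        (by simp only [g, add_zero, hxy t₀ le_rfl]; omega) B le_rfl
      simp only [g] at this
      linarith
  -- Both walls come from the past `x` alone, so this `α` serves all continuations `y` at once.
  refine ⟨min (f k B) (f (k + 1) B) - horiz x t₀, fun y hy hav => ?_⟩
  have hxy : horiz y t₀ = horiz x t₀ := horiz_congr hy
  have h1 := key y hy hav k
  have h2 := key y hy hav (k + 1)
  have h3 := abs_le.1 (hgap k)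
  rw [hxy]
  rcases hk with ⟨ha, hb⟩ | ⟨ha, hb⟩
  · have h4 := h1.1 ha
    have h5 := h2.2 hb
    omega
  · have h4 := h2.1 ha
    have h5 := h1.2 hb
    omega

/-! ### Counting avoiding words block by block -/

/-- A finite word, continued by `false`. -/
def ext {T : ℕ} (u : Fin T → Bool) (i : ℕ) : Bool := if h : i < T then u ⟨i, h⟩ else false

theorem ext_of_lt {T : ℕ} (u : Fin T → Bool) {i : ℕ} (h : i < T) : ext u i = u ⟨i, h⟩ := dif_pos h

theorem card_horiz_eq_le (B j : ℕ) :
    (Finset.univ.filter fun b : Fin B → Bool => horiz (ext b) B = j).card ≤ B.choose j := by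
  have h : (Finset.powersetCard j (Finset.univ : Finset (Fin B))).card = B.choose j := by
    rw [Finset.card_powersetCard, Finset.card_univ, Fintype.card_fin]
  rw [← h]
  refine Finset.card_le_card_of_injOn (fun b => Finset.univ.filter fun i => b i = true) ?_ ?_
  · intro b hb
    have hb' : horiz (ext b) B = j := by simpa using hb
    rw [Finset.mem_coe, Finset.mem_powersetCard]
    refine ⟨Finset.subset_univ _, ?_⟩
    rw [← hb', Finset.card_filter, horiz, ← Fin.sum_univ_eq_sum_range (fun i => (ext b i).toNat)]
    refine Finset.sum_congr rfl fun i _ => ?_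
    rw [ext_of_lt b i.2]
    cases b i <;> simp
  · intro b _ b' _ h
    funext i
    have := congrArg (i ∈ ·) h
    simp only [Finset.mem_filter, Finset.mem_univ, true_and, eq_iff_iff] at this
    exact Bool.eq_iff_iff.2 this

theorem card_horiz_mem_Icc_le (B R : ℕ) (α : ℤ) :
    (Finset.univ.filter fun b : Fin B → Bool =>
      α ≤ (horiz (ext b) B : ℤ) ∧ (horiz (ext b) B : ℤ) ≤ α + R).card
      ≤ (R + 1) * B.choose (B / 2) := by
  have hcard : ((Finset.Icc α (α + R)).card : ℕ) = R + 1 := by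
    rw [Int.card_Icc]
    omega
  rw [← hcard, mul_comm]
  refine (Finset.card_le_mul_card_image_of_maps_to
    (f := fun b : Fin B → Bool => (horiz (ext b) B : ℤ)) (t := Finset.Icc α (α + R)) ?_ _ ?_)
  · intro b hb
    simpa using hb
  · intro z hz
    rcases le_or_gt 0 z with h | h
    · lift z to ℕ using h
      refine le_trans (Finset.card_le_card ?_) ((card_horiz_eq_le B z).trans (Nat.choose_le_middle z B))
      intro b hb
      simp only [Finset.mem_filter, Finset.mem_univ, true_and] at hb ⊢
      exact_mod_cast hb.2
    · rw [Finset.card_eq_zero.2]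
      · exact Nat.zero_le _
      · refine Finset.filter_eq_empty_iff.2 fun b _ hb => ?_
        omega

theorem centralBinom_sq_le (k : ℕ) : (2 * k + 1) * k.centralBinom ^ 2 ≤ 16 ^ k := by
  induction k with
  | zero => simp
  | succ k ih =>
    have h := Nat.succ_mul_centralBinom_succ k
    have h2 : (k + 1) ^ 2 * ((2 * (k + 1) + 1) * (k + 1).centralBinom ^ 2)
        ≤ (k + 1) ^ 2 * 16 ^ (k + 1) := by
      calc (k + 1) ^ 2 * ((2 * (k + 1) + 1) * (k + 1).centralBinom ^ 2)
          = (2 * (k + 1) + 1) * ((k + 1) * (k + 1).centralBinom) ^ 2 := by ring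
        _ = (2 * k + 3) * (2 * k + 1) * 4 * ((2 * k + 1) * k.centralBinom ^ 2) := by rw [h]; ring
        _ ≤ (4 * (k + 1) ^ 2) * 4 * 16 ^ k := by
            have h3 : (2 * k + 3) * (2 * k + 1) ≤ 4 * (k + 1) ^ 2 := by nlinarith
            gcongr
        _ = (k + 1) ^ 2 * 16 ^ (k + 1) := by ring
    exact le_of_mul_le_mul_left h2 (by positivity)

/-- This fixes the block length: the middle binomial coefficient of `B` is at most `2 ^ B / √(B +
1)`, and `√B = 2 (R + 1)`. -/
theorem two_mul_choose_middle_le (R : ℕ) :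
    2 * ((R + 1) * (4 * (R + 1) ^ 2).choose (4 * (R + 1) ^ 2 / 2)) ≤ 2 ^ (4 * (R + 1) ^ 2) := by
  set k := 2 * (R + 1) ^ 2 with hk
  have h1 : 4 * (R + 1) ^ 2 = 2 * k := by rw [hk]; ring
  rw [h1, Nat.mul_div_cancel_left k two_pos]
  have h2 := centralBinom_sq_le k
  rw [Nat.centralBinom] at h2
  refine (Nat.pow_le_pow_iff_left two_ne_zero).1 ?_
  calc (2 * ((R + 1) * (2 * k).choose k)) ^ 2
      = (4 * (R + 1) ^ 2) * (2 * k).choose k ^ 2 := by ring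
    _ ≤ (2 * k + 1) * (2 * k).choose k ^ 2 := by gcongr; omega
    _ ≤ 16 ^ k := h2
    _ = (2 ^ (2 * k)) ^ 2 := by
        rw [← pow_mul, show 2 * k * 2 = 4 * k by ring, pow_mul 2 4 k, show 2 ^ 4 = 16 by norm_num]

open Classical in
/-- The words of length `T` that drive an avoiding walk and are balanced up to time `M`. -/
noncomputable def goodWords (n m M τ τ' : ℕ) (c c' R : ℤ) (T : ℕ) : Finset (Fin T → Bool) :=
  Finset.univ.filter fun u => Avoids n m (ext u) T ∧ Balanced (ext u) M τ c R ∧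
    Balanced (ext u) M τ' c' R

theorem Avoids.congr {n m T : ℕ} {x y : ℕ → Bool} (h : Avoids n m x T) (hxy : ∀ i < T, x i = y i) :
    Avoids n m y T := by
  intro s t hst ht
  rw [← horiz_congr (x := x) (y := y) fun i hi => hxy i (by omega),
    ← horiz_congr (x := x) (y := y) (t := s) fun i hi => hxy i (by omega)]
  exact h s t hst ht

theorem Avoids.mono {n m T T' : ℕ} {x : ℕ → Bool} (h : Avoids n m x T) (hT : T' ≤ T) :
    Avoids n m x T' := fun s t hst ht => h s t hst (ht.trans hT)

theorem Balanced.congr {M τ : ℕ} {c R : ℤ} {x y : ℕ → Bool} (h : Balanced x M τ c R)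
    (hxy : ∀ i < M, x i = y i) : Balanced y M τ c R := by
  intro s hs
  rw [← horiz_congr (x := x) (y := y) fun i hi => hxy i (by omega),
    ← horiz_congr (x := x) (y := y) (t := s) fun i hi => hxy i (by omega)]
  exact h s hs

/-- Fibre the good words over their prefix of length `T`. By `confinement` the last block has its
horizontal count in an interval fixed by the prefix. Balance is required only up to `M`, so it
passes to prefixes. -/
theorem card_goodWords_add_le {n m p q p' q' τ τ' B M R : ℕ} (hn : 0 < n) (hm : 0 < m)
    (hτ : τ = p * n + q * m) (hτ' : τ' = p' * n + q' * m)
    (hdet : (p : ℤ) * q' ≠ q * p') (hM : τ + τ' + B ≤ M) {T : ℕ} (hT : M ≤ T) :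
    (goodWords n m M τ τ' (p * n) (p' * n) R (T + B)).card
      ≤ (R + 1) * B.choose (B / 2) * (goodWords n m M τ τ' (p * n) (p' * n) R T).card := by
  classical
  have hext : ∀ (w : Fin (T + B) → Bool) i, i < T →
      ext w i = ext (fun i : Fin T => w (Fin.castAdd B i)) i := by
    intro w i hi
    rw [ext_of_lt _ hi, ext_of_lt _ (by omega)]
    rfl
  refine Finset.card_le_mul_card_image_of_maps_to (f := fun w i => w (Fin.castAdd B i)) ?_ _ ?_
  · intro w hw
    simp only [goodWords, Finset.mem_filter, Finset.mem_univ, true_and] at hw ⊢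
    exact ⟨(hw.1.mono (by omega)).congr (hext w), hw.2.1.congr fun i hi => hext w i (by omega),
      hw.2.2.congr fun i hi => hext w i (by omega)⟩
  · intro u hu
    simp only [goodWords, Finset.mem_filter, Finset.mem_univ, true_and] at hu
    obtain ⟨α, hα⟩ := confinement hn hm hτ hτ' hdet hM hT (ext u) hu.2.1 hu.2.2
    refine le_trans ?_ (card_horiz_mem_Icc_le B R α)
    refine Finset.card_le_card_of_injOn (fun w i => w (Fin.natAdd T i)) ?_ ?_
    · intro w hw
      simp only [goodWords, Finset.coe_filter, Finset.mem_filter, Finset.mem_univ, true_and,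
        Set.mem_ofPred_eq] at hw ⊢
      obtain ⟨⟨hav, -, -⟩, rfl⟩ := hw
      have h := hα (ext w) (hext w) hav
      have h1 : horiz (ext w) (T + B) = horiz (ext w) T +
          horiz (ext fun i : Fin B => w (Fin.natAdd T i)) B := by
        rw [horiz_add]
        congr 1
        refine horiz_congr fun i hi => ?_
        rw [ext_of_lt _ hi, ext_of_lt _ (by omega)]
        rfl
      rw [h1] at h
      push_cast at h
      simpa using h
    · intro w hw w' hw' h
      simp only [goodWords, Finset.coe_filter, Finset.mem_filter, Finset.mem_univ, true_and,
        Set.mem_ofPred_eq] at hw hw'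
      funext i
      refine Fin.addCases (fun i => ?_) (fun i => ?_) i
      · exact congrFun (hw.2.trans hw'.2.symm) i
      · exact congrFun h i

theorem card_goodWords_le {n m p q p' q' τ τ' M R : ℕ} (hn : 0 < n) (hm : 0 < m)
    (hτ : τ = p * n + q * m) (hτ' : τ' = p' * n + q' * m)
    (hdet : (p : ℤ) * q' ≠ q * p') (hM : τ + τ' + 4 * (R + 1) ^ 2 ≤ M) (J : ℕ) :
    2 ^ J * (goodWords n m M τ τ' (p * n) (p' * n) R (M + J * (4 * (R + 1) ^ 2))).card
      ≤ 2 ^ (M + J * (4 * (R + 1) ^ 2)) := by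
  induction J with
  | zero =>
    refine (Nat.mul_le_mul_left _ (Finset.card_le_univ _)).trans (le_of_eq ?_)
    simp
  | succ J ih =>
    have h := card_goodWords_add_le (R := R) hn hm hτ hτ' hdet hM
      (T := M + J * (4 * (R + 1) ^ 2)) (by omega)
    have h2 := two_mul_choose_middle_le R
    rw [show M + (J + 1) * (4 * (R + 1) ^ 2) = M + J * (4 * (R + 1) ^ 2) + 4 * (R + 1) ^ 2 by ring,
      pow_add 2 (M + J * (4 * (R + 1) ^ 2))]
    calc _ ≤ 2 ^ (J + 1) * _ := Nat.mul_le_mul_left _ h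
      _ = (2 ^ J * (goodWords n m M τ τ' (p * n) (p' * n) R (M + J * (4 * (R + 1) ^ 2))).card) *
          (2 * ((R + 1) * (4 * (R + 1) ^ 2).choose (4 * (R + 1) ^ 2 / 2))) := by ring
      _ ≤ _ := Nat.mul_le_mul ih h2

/-! ### Concentration of the horizontal count -/

/-- The exponential moment factorises over the letters, each contributing `2 * cosh z ≤ 2 * exp (z ^
2 / 2)` on `A`. -/
theorem sum_exp_le (T : ℕ) (A : Finset (Fin T)) (z : ℝ) :
    ∑ u : Fin T → Bool, Real.exp (z * ∑ i ∈ A, (2 * ((u i).toNat : ℝ) - 1))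
      ≤ 2 ^ T * Real.exp (A.card * (z ^ 2 / 2)) := by
  classical
  let f : Fin T → Bool → ℝ := fun i b =>
    if i ∈ A then Real.exp (z * (2 * (b.toNat : ℝ) - 1)) else 1
  have h1 : ∀ u : Fin T → Bool, Real.exp (z * ∑ i ∈ A, (2 * ((u i).toNat : ℝ) - 1))
      = ∏ i, f i (u i) := by
    intro u
    rw [Finset.mul_sum, Real.exp_sum]
    simp only [f]
    rw [Finset.prod_ite_mem, Finset.univ_inter]
  have h2 : ∏ i, ∑ b, f i b = ∑ u : Fin T → Bool, ∏ i, f i (u i) := by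
    rw [Finset.prod_univ_sum, Fintype.piFinset_univ]
  rw [Finset.sum_congr rfl fun u _ => h1 u, ← h2]
  have h3 : ∀ i, ∑ b, f i b ≤ 2 * (if i ∈ A then Real.exp (z ^ 2 / 2) else 1) := by
    intro i
    rw [Fintype.sum_bool]
    simp only [f]
    split_ifs
    · have := Real.cosh_le_exp_half_sq z
      rw [Real.cosh_eq] at this
      simp only [Bool.toNat_true, Bool.toNat_false]
      norm_num
      linarith
    · norm_num
  calc ∏ i, ∑ b, f i b ≤ ∏ i, 2 * (if i ∈ A then Real.exp (z ^ 2 / 2) else 1) := by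
        refine Finset.prod_le_prod (fun i _ => Finset.sum_nonneg fun b _ => ?_) fun i _ => h3 i
        simp only [f]
        split_ifs <;> positivity
    _ = _ := by
        rw [Finset.prod_mul_distrib, Finset.prod_ite_mem, Finset.univ_inter, Finset.prod_const,
          Finset.prod_const, Finset.card_univ, Fintype.card_fin, ← Real.exp_nat_mul]

/-- Hoeffding's inequality for the number of horizontal moves in a time window. -/
theorem card_deviation_le {T s τ : ℕ} (hτ : 0 < τ) (hs : s + τ ≤ T) (a : ℝ) (ha : 0 ≤ a) :
    ((Finset.univ.filter fun u : Fin T → Bool =>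
      a ≤ |2 * ((horiz (ext u) (s + τ) : ℝ) - horiz (ext u) s) - τ|).card : ℝ)
      ≤ 2 ^ T * (2 * Real.exp (-(a ^ 2 / (2 * τ)))) := by
  classical
  set A : Finset (Fin T) := Finset.univ.filter fun i => s ≤ (i : ℕ) ∧ (i : ℕ) < s + τ with hA
  have hsumA : ∀ g : ℕ → ℝ, ∑ i ∈ A, g i = ∑ i ∈ Finset.Ico s (s + τ), g i := by
    intro g
    rw [hA, Finset.sum_filter,
      Fin.sum_univ_eq_sum_range (fun i => if s ≤ i ∧ i < s + τ then g i else 0) T,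
      ← Finset.sum_filter]
    refine Finset.sum_congr ?_ fun _ _ => rfl
    ext i
    simp only [Finset.mem_filter, Finset.mem_range, Finset.mem_Ico]
    omega
  have hcard : (A.card : ℝ) = τ := by
    have := hsumA fun _ => 1
    simpa using this
  have hdev : ∀ u : Fin T → Bool, 2 * ((horiz (ext u) (s + τ) : ℝ) - horiz (ext u) s) - τ
      = ∑ i ∈ A, (2 * ((u i).toNat : ℝ) - 1) := by
    intro u
    have h1 : ∑ i ∈ A, (2 * ((u i).toNat : ℝ) - 1) = ∑ i ∈ A, (2 * ((ext u i).toNat : ℝ) - 1) :=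
      Finset.sum_congr rfl fun i _ => by rw [ext_of_lt u i.2]
    rw [h1, hsumA fun i => 2 * ((ext u i).toNat : ℝ) - 1, Finset.sum_sub_distrib, ← Finset.mul_sum,
      Finset.sum_Ico_eq_sub _ (Nat.le_add_right s τ)]
    simp [horiz]
  have hτ' : (0 : ℝ) < τ := by exact_mod_cast hτ
  -- The optimal Chernoff parameter, minimising `τ * z ^ 2 / 2 - z * a`.
  set z : ℝ := a / τ with hz
  have hz0 : 0 ≤ z := by positivity
  have key : ((Finset.univ.filter fun u : Fin T → Bool =>
      a ≤ |2 * ((horiz (ext u) (s + τ) : ℝ) - horiz (ext u) s) - τ|).card : ℝ) * Real.exp (z * a)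
      ≤ 2 ^ T * (2 * Real.exp (τ * (z ^ 2 / 2))) := by
    calc _ = ∑ u ∈ Finset.univ.filter fun u : Fin T → Bool =>
          a ≤ |2 * ((horiz (ext u) (s + τ) : ℝ) - horiz (ext u) s) - τ|, Real.exp (z * a) := by
          rw [Finset.sum_const, nsmul_eq_mul]
      _ ≤ ∑ u ∈ Finset.univ.filter fun u : Fin T → Bool =>
          a ≤ |2 * ((horiz (ext u) (s + τ) : ℝ) - horiz (ext u) s) - τ|,
          (Real.exp (z * ∑ i ∈ A, (2 * ((u i).toNat : ℝ) - 1)) +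
            Real.exp (-z * ∑ i ∈ A, (2 * ((u i).toNat : ℝ) - 1))) := by
          refine Finset.sum_le_sum fun u hu => ?_
          rw [Finset.mem_filter, hdev] at hu
          rcases le_abs.1 hu.2 with h | h
          · have : Real.exp (z * a) ≤ Real.exp (z * ∑ i ∈ A, (2 * ((u i).toNat : ℝ) - 1)) :=
              Real.exp_le_exp.2 (mul_le_mul_of_nonneg_left h hz0)
            linarith [Real.exp_pos (-z * ∑ i ∈ A, (2 * ((u i).toNat : ℝ) - 1))]
          · have : Real.exp (z * a) ≤ Real.exp (-z * ∑ i ∈ A, (2 * ((u i).toNat : ℝ) - 1)) := by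
              refine Real.exp_le_exp.2 ((mul_le_mul_of_nonneg_left h hz0).trans (le_of_eq ?_))
              ring
            linarith [Real.exp_pos (z * ∑ i ∈ A, (2 * ((u i).toNat : ℝ) - 1))]
      _ ≤ ∑ u : Fin T → Bool, (Real.exp (z * ∑ i ∈ A, (2 * ((u i).toNat : ℝ) - 1)) +
            Real.exp (-z * ∑ i ∈ A, (2 * ((u i).toNat : ℝ) - 1))) :=
          Finset.sum_le_univ_sum_of_nonneg fun u => by positivity
      _ ≤ 2 ^ T * (2 * Real.exp (τ * (z ^ 2 / 2))) := by
          rw [Finset.sum_add_distrib]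
          have h1 := sum_exp_le T A z
          have h2 := sum_exp_le T A (-z)
          rw [hcard] at h1 h2
          rw [neg_sq] at h2
          linarith
  rw [← le_div_iff₀ (Real.exp_pos _), mul_div_assoc, mul_div_assoc, ← Real.exp_sub] at key
  have hexp : (τ : ℝ) * (z ^ 2 / 2) - z * a = -(a ^ 2 / (2 * τ)) := by
    rw [hz]
    field_simp
    ring
  rwa [hexp] at key

theorem card_not_balanced_le {n m p q τ M T R : ℕ} (hτ : τ = p * n + q * m) (hτ0 : 0 < τ)
    (hM : M ≤ T) (hR : |(p : ℤ) * n - q * m| ≤ R) [DecidablePred fun u : Fin T → Bool =>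
      ¬ Balanced (ext u) M τ (p * n) R] :
    ((Finset.univ.filter fun u : Fin T → Bool => ¬ Balanced (ext u) M τ (p * n) R).card : ℝ)
      ≤ M * (2 ^ T * (2 * Real.exp (-((R : ℝ) ^ 2 / (2 * τ))))) := by
  classical
  let F : ℕ → Finset (Fin T → Bool) := fun s => if s + τ ≤ M then
    Finset.univ.filter fun u : Fin T → Bool =>
      (R : ℝ) ≤ |2 * ((horiz (ext u) (s + τ) : ℝ) - horiz (ext u) s) - τ| else ∅
  have hsub : (Finset.univ.filter fun u : Fin T → Bool => ¬ Balanced (ext u) M τ (p * n) R)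
      ⊆ (Finset.range M).biUnion F := by
    intro u hu
    have hu := (Finset.mem_filter.1 hu).2
    rw [Balanced] at hu
    push Not at hu
    obtain ⟨s, hs, hu⟩ := hu
    refine Finset.mem_biUnion.2 ⟨s, Finset.mem_range.2 (by omega), ?_⟩
    simp only [F, if_pos hs, Finset.mem_filter, Finset.mem_univ, true_and]
    -- Doubling the count turns its centre `p n` into `τ + (p n - q m)`; a deviation of `2 R` from
    -- there is at least `R` from `τ`.
    have h1 : (R : ℤ) ≤ |2 * ((horiz (ext u) (s + τ) : ℤ) - horiz (ext u) s) - τ| := by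
      have h2 : (τ : ℤ) = p * n + q * m := by exact_mod_cast hτ
      rw [abs_le] at hR
      rw [lt_abs] at hu
      rw [le_abs]
      omega
    exact_mod_cast h1
  calc _ ≤ (((Finset.range M).biUnion F).card : ℝ) := by exact_mod_cast Finset.card_le_card hsub
    _ ≤ ∑ s ∈ Finset.range M, ((F s).card : ℝ) := by exact_mod_cast Finset.card_biUnion_le
    _ ≤ ∑ s ∈ Finset.range M, 2 ^ T * (2 * Real.exp (-((R : ℝ) ^ 2 / (2 * τ)))) := by
        refine Finset.sum_le_sum fun s _ => ?_
        by_cases h : s + τ ≤ M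
        · simp only [F, if_pos h]
          exact card_deviation_le hτ0 (by omega) R (Nat.cast_nonneg R)
        · simp only [F, if_neg h, Finset.card_empty, Nat.cast_zero]
          positivity
    _ = _ := by rw [Finset.sum_const, Finset.card_range, nsmul_eq_mul]

open Classical in
theorem card_avoids_le {n m p q p' q' τ τ' M R : ℕ} (hn : 0 < n) (hm : 0 < m)
    (hτ : τ = p * n + q * m) (hτ' : τ' = p' * n + q' * m) (hτ0 : 0 < τ) (hτ0' : 0 < τ')
    (hdet : (p : ℤ) * q' ≠ q * p') (hM : τ + τ' + 4 * (R + 1) ^ 2 ≤ M)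
    (hR : |(p : ℤ) * n - q * m| ≤ R) (hR' : |(p' : ℤ) * n - q' * m| ≤ R) (J : ℕ) {T : ℕ}
    (hT : T = M + J * (4 * (R + 1) ^ 2)) :
    ((Finset.univ.filter fun u : Fin T → Bool => Avoids n m (ext u) T).card : ℝ)
      ≤ 2 ^ T * ((1 / 2) ^ J + M * (2 * Real.exp (-((R : ℝ) ^ 2 / (2 * τ)))) +
        M * (2 * Real.exp (-((R : ℝ) ^ 2 / (2 * τ'))))) := by
  have hMT : M ≤ T := by omega
  have h1 := card_goodWords_le (R := R) hn hm hτ hτ' hdet hM J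
  rw [← hT] at h1
  have h2 := card_not_balanced_le hτ hτ0 hMT hR
  have h3 := card_not_balanced_le hτ' hτ0' hMT hR'
  have hsub : (Finset.univ.filter fun u : Fin T → Bool => Avoids n m (ext u) T) ⊆
      goodWords n m M τ τ' (p * n) (p' * n) R T ∪
      (Finset.univ.filter fun u : Fin T → Bool => ¬ Balanced (ext u) M τ (p * n) R) ∪
      (Finset.univ.filter fun u : Fin T → Bool => ¬ Balanced (ext u) M τ' (p' * n) R) := by
    intro u hu
    simp only [goodWords, Finset.mem_union, Finset.mem_filter, Finset.mem_univ, true_and] at hu ⊢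
    tauto
  have h4 := (Finset.card_le_card hsub).trans
    ((Finset.card_union_le _ _).trans (Nat.add_le_add_right (Finset.card_union_le _ _) _))
  have h5 : ((goodWords n m M τ τ' (p * n) (p' * n) R T).card : ℝ) ≤ 2 ^ T * (1 / 2) ^ J := by
    rw [one_div, inv_pow, ← div_eq_mul_inv, le_div_iff₀ (by positivity), mul_comm]
    exact_mod_cast h1
  refine (Nat.cast_le.2 h4).trans ?_
  push_cast
  linarith

/-! ### From the random map to words -/

/-- The vertex reached from `v` after `t` steps along the word `x`. -/
def vertexAt {n m : ℕ} (v : Torus n m) (x : ℕ → Bool) (t : ℕ) : Torus n m :=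
  (v.1 + (horiz x t : ZMod n), v.2 + ((t : ZMod m) - (horiz x t : ZMod m)))

theorem vertexAt_eq_iff {n m : ℕ} (v : Torus n m) (x : ℕ → Bool) (s t : ℕ) :
    vertexAt v x s = vertexAt v x t ↔ (n : ℤ) ∣ (horiz x t : ℤ) - horiz x s ∧
      (m : ℤ) ∣ ((t : ℤ) - horiz x t) - ((s : ℤ) - horiz x s) := by
  rw [← ZMod.intCast_zmod_eq_zero_iff_dvd, ← ZMod.intCast_zmod_eq_zero_iff_dvd, vertexAt, vertexAt,
    Prod.mk.injEq, add_right_inj, add_right_inj]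
  push_cast
  rw [sub_eq_zero, sub_eq_zero, eq_comm, @eq_comm (ZMod m)]

theorem iterate_step_eq {n m : ℕ} (ω : Torus n m → Bool) (v : Torus n m) (t : ℕ) :
    (step ω)^[t] v = vertexAt v (fun i => ω ((step ω)^[i] v)) t := by
  induction t with
  | zero => simp [vertexAt, horiz]
  | succ t ih =>
    rw [Function.iterate_succ_apply']
    have h : step ω ((step ω)^[t] v) = if ω ((step ω)^[t] v) then
      (((step ω)^[t] v).1 + 1, ((step ω)^[t] v).2) else
      (((step ω)^[t] v).1, ((step ω)^[t] v).2 + 1) := rfl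
    rw [h]
    have h1 : ((step ω)^[t] v).1 = v.1 + (horiz (fun i => ω ((step ω)^[i] v)) t : ZMod n) := by
      conv_lhs => rw [ih]
      rfl
    have h2 : ((step ω)^[t] v).2 =
        v.2 + ((t : ZMod m) - (horiz (fun i => ω ((step ω)^[i] v)) t : ZMod m)) := by
      conv_lhs => rw [ih]
      rfl
    rw [h1, h2, vertexAt, horiz_succ]
    cases ω ((step ω)^[t] v)
    · simp only [Bool.false_eq_true, if_false, Bool.toNat_false, Nat.cast_add,
        Nat.cast_one, add_zero, Prod.mk.injEq, true_and]
      ring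
    · simp only [if_true, Bool.toNat_true, Nat.cast_add, Nat.cast_one, Prod.mk.injEq]
      constructor <;> ring

instance : IsProbabilityMeasure fairCoin := PMF.toMeasure.isProbabilityMeasure _

instance (n m : ℕ) [NeZero n] [NeZero m] : IsProbabilityMeasure (law n m) := by
  unfold law
  infer_instance

theorem fairCoin_singleton (b : Bool) : fairCoin {b} = 2⁻¹ := by
  rw [fairCoin, PMF.toMeasure_apply_singleton _ _ (measurableSet_singleton b)]
  simp

/-- Distinct positions carry independent coins; positions outside the range of `pos` cost a factor
at most one. -/
theorem law_cylinder_le {n m : ℕ} [NeZero n] [NeZero m] {T : ℕ} (pos : Fin T → Torus n m)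
    (hpos : Function.Injective pos) (u : Fin T → Bool) :
    law n m {ω | ∀ t, ω (pos t) = u t} ≤ 2⁻¹ ^ T := by
  classical
  let A : Torus n m → Set Bool := fun z => {b | ∀ t, pos t = z → b = u t}
  have hsub : {ω : Torus n m → Bool | ∀ t, ω (pos t) = u t} ⊆ Set.univ.pi A := by
    intro ω hω z _ t ht
    rw [← ht]
    exact hω t
  refine (measure_mono hsub).trans ?_
  rw [law, Measure.pi_pi]
  calc ∏ z, fairCoin (A z) ≤ ∏ z ∈ Finset.univ.image pos, fairCoin (A z) :=
        Finset.prod_le_prod_of_subset_of_le_one' (Finset.subset_univ _) fun _ _ _ => prob_le_one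
    _ = ∏ t, fairCoin (A (pos t)) := Finset.prod_image fun _ _ _ _ h => hpos h
    _ ≤ ∏ _t : Fin T, 2⁻¹ := by
        refine Finset.prod_le_prod' fun t _ => ?_
        rw [← fairCoin_singleton (u t)]
        exact measure_mono fun b hb => hb t rfl
    _ = 2⁻¹ ^ T := by rw [Finset.prod_const, Finset.card_univ, Fintype.card_fin]

open Classical in
/-- The probability of a long cycle is at most the expected number of starting vertices times the
proportion of avoiding words. -/
theorem law_longCycle_le {n m : ℕ} [NeZero n] [NeZero m] {T : ℕ} {L : ℝ} (hL : (T : ℝ) + 1 ≤ L) :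
    (law n m).real (longCycle n m L) ≤ (n : ℝ) * m *
      (((Finset.univ.filter fun u : Fin T → Bool => Avoids n m (ext u) T).card : ℝ) * 2⁻¹ ^ T) := by
  set S := Finset.univ.filter fun u : Fin T → Bool => Avoids n m (ext u) T with hS
  let cyl : Torus n m → (Fin T → Bool) → Set (Torus n m → Bool) := fun v u =>
    {ω | ∀ t : Fin T, ω (vertexAt v (ext u) t) = u t}
  have hsub : longCycle n m L ⊆ ⋃ v ∈ (Finset.univ : Finset (Torus n m)), ⋃ u ∈ S, cyl v u := by
    rintro ω ⟨v, -, hv⟩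
    have hT : T < Function.minimalPeriod (step ω) v := by
      have : (T : ℝ) + 1 ≤ Function.minimalPeriod (step ω) v := hL.trans hv
      exact_mod_cast this
    set x : ℕ → Bool := fun i => ω ((step ω)^[i] v) with hx
    let u : Fin T → Bool := fun i => x i
    have hux : ∀ i < T, ext u i = x i := fun i hi => ext_of_lt u hi
    simp only [Set.mem_iUnion]
    refine ⟨v, Finset.mem_univ v, u, ?_, ?_⟩
    · rw [hS, Finset.mem_filter]
      refine ⟨Finset.mem_univ _, Avoids.congr (x := x) ?_ fun i hi => (hux i hi).symm⟩
      intro s t hst ht hdvd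
      rw [← vertexAt_eq_iff v, ← iterate_step_eq, ← iterate_step_eq] at hdvd
      have := Function.iterate_injOn_Iio_minimalPeriod (f := step ω) (x := v)
        (Set.mem_Iio.2 (by omega : s < _)) (Set.mem_Iio.2 (by omega : t < _)) hdvd
      omega
    · intro t
      have h1 : vertexAt v (ext u) t = vertexAt v x t := by
        rw [vertexAt, vertexAt, horiz_congr (x := ext u) (y := x) fun i hi => hux i (by omega)]
      rw [h1, hx, ← iterate_step_eq]
  have hcyl : ∀ v, ∀ u ∈ S, (law n m).real (cyl v u) ≤ 2⁻¹ ^ T := by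
    intro v u hu
    have hav := (Finset.mem_filter.1 hu).2
    have hinj : Function.Injective fun t : Fin T => vertexAt v (ext u) t := by
      intro s t h
      by_contra hne
      rcases lt_or_gt_of_ne (fun h => hne (Fin.ext h) : (s : ℕ) ≠ t) with h' | h'
      · exact hav s t h' (by omega) ((vertexAt_eq_iff v _ _ _).1 h)
      · exact hav t s h' (by omega) ((vertexAt_eq_iff v _ _ _).1 h.symm)
    have := ENNReal.toReal_mono (by simp) (law_cylinder_le _ hinj u)
    simpa [Measure.real] using this
  calc (law n m).real (longCycle n m L)
      ≤ (law n m).real (⋃ v ∈ (Finset.univ : Finset (Torus n m)), ⋃ u ∈ S, cyl v u) :=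
        measureReal_mono hsub (measure_ne_top _ _)
    _ ≤ ∑ v : Torus n m, (law n m).real (⋃ u ∈ S, cyl v u) := measureReal_biUnion_finset_le _ _
    _ ≤ ∑ v : Torus n m, ∑ u ∈ S, (law n m).real (cyl v u) :=
        Finset.sum_le_sum fun v _ => measureReal_biUnion_finset_le _ _
    _ ≤ ∑ v : Torus n m, ∑ u ∈ S, 2⁻¹ ^ T :=
        Finset.sum_le_sum fun v _ => Finset.sum_le_sum fun u hu => hcyl v u hu
    _ = _ := by
        rw [Finset.sum_const, Finset.sum_const, Finset.card_univ, Fintype.card_prod, ZMod.card,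
          ZMod.card, nsmul_eq_mul, nsmul_eq_mul]
        push_cast
        ring

theorem law_longCycle_le_of_lattice {n m p q p' q' τ τ' M R : ℕ} [NeZero n] [NeZero m]
    (hτ : τ = p * n + q * m) (hτ' : τ' = p' * n + q' * m) (hτ0 : 0 < τ) (hτ0' : 0 < τ')
    (hdet : (p : ℤ) * q' ≠ q * p') (hM : τ + τ' + 4 * (R + 1) ^ 2 ≤ M)
    (hR : |(p : ℤ) * n - q * m| ≤ R) (hR' : |(p' : ℤ) * n - q' * m| ≤ R) (J : ℕ) {L : ℝ}
    (hL : ((M + J * (4 * (R + 1) ^ 2) : ℕ) : ℝ) + 1 ≤ L) :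
    (law n m).real (longCycle n m L) ≤ (n : ℝ) * m *
      ((1 / 2) ^ J + M * (2 * Real.exp (-((R : ℝ) ^ 2 / (2 * τ)))) +
        M * (2 * Real.exp (-((R : ℝ) ^ 2 / (2 * τ'))))) := by
  classical
  refine (law_longCycle_le hL).trans ?_
  have h := card_avoids_le (NeZero.pos n) (NeZero.pos m) hτ hτ' hτ0 hτ0' hdet hM hR hR' J rfl
  refine mul_le_mul_of_nonneg_left ?_ (by positivity)
  rw [inv_pow, ← div_eq_mul_inv, div_le_iff₀ (by positivity)]
  exact h.trans_eq (mul_comm _ _)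

/-! ### Convergents of `m / n` -/

/-- The continuants of a number at least one are natural numbers and grow. -/
theorem exists_nat_contsAux {v : ℝ} (hv : 1 ≤ v) (j : ℕ) :
    ∃ A B A' B' : ℕ, (GenContFract.of v).contsAux j = ⟨A, B⟩ ∧
      (GenContFract.of v).contsAux (j + 1) = ⟨A', B'⟩ ∧ 1 ≤ A ∧ A ≤ A' ∧ 1 ≤ B' ∧ B ≤ B' := by
  induction j with
  | zero =>
    refine ⟨1, 0, ⌊v⌋₊, 1, ?_, ?_, le_rfl, Nat.le_floor (by exact_mod_cast hv), le_rfl, zero_le_one⟩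
    · simp [GenContFract.zeroth_contAux_eq_one_zero]
    · rw [GenContFract.first_contAux_eq_h_one, GenContFract.of_h_eq_floor,
        ← natCast_floor_eq_intCast_floor (by linarith), Nat.cast_one]
  | succ j ih =>
    obtain ⟨A, B, A', B', h1, h2, h3, h4, h5, h6⟩ := ih
    rcases hs : (GenContFract.of v).s.get? j with _ | gp
    · refine ⟨A', B', A', B', h2, ?_, h3.trans h4, le_rfl, h5, le_rfl⟩
      rw [← h2]
      exact GenContFract.contsAux_stable_step_of_terminated hs
    · obtain ⟨ha, z, hz⟩ := GenContFract.of_partNum_eq_one_and_exists_int_partDen_eq hs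
      have hz1 : (1 : ℝ) ≤ z := by
        rw [← hz]
        exact GenContFract.of_one_le_get?_partDen (GenContFract.partDen_eq_s_b hs)
      have hz2 : 1 ≤ z := by exact_mod_cast hz1
      lift z to ℕ using by omega
      have hz3 : 1 ≤ z := by exact_mod_cast hz2
      refine ⟨A', B', z * A' + A, z * B' + B, h2, ?_, h3.trans h4, ?_, ?_, ?_⟩
      · rw [GenContFract.contsAux_recurrence hs h1 h2, ha, hz]
        push_cast
        simp
      · nlinarith
      · nlinarith
      · nlinarith

/-- Two consecutive convergents of `m / n`. -/
theorem exists_convergents {n m k : ℕ} {a : ℝ} (hn : 0 < n) (hnm : n ≤ m)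
    (ha : IsPartialQuotientSucc n m k a) :
    ∃ p q p' q' : ℕ, convNum n m k = p ∧ convNum n m (k + 1) = p' ∧ 1 ≤ p ∧ p ≤ p' ∧
      (p' : ℝ) ≤ (a + 1) * p ∧ 1 ≤ q' ∧ (p : ℤ) * q' ≠ q * p' ∧
      |(p : ℝ) * n - q * m| * q' ≤ n ∧ |(p' : ℝ) * n - q' * m| * q' ≤ n := by
  have hn' : (0 : ℝ) < n := by exact_mod_cast hn
  set v : ℝ := (m : ℝ) / n with hv
  have hv1 : 1 ≤ v := by
    rw [hv, le_div_iff₀ hn', one_mul]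
    exact_mod_cast hnm
  have hvn : v * n = m := div_mul_cancel₀ _ hn'.ne'
  obtain ⟨A, B, p, q, h1, h2, h3, h4, h5, -⟩ := exists_nat_contsAux hv1 k
  obtain ⟨p₀, q₀, p', q', h2', h6, -, h7, h8, -⟩ := exists_nat_contsAux hv1 (k + 1)
  rw [h2, GenContFract.Pair.mk.injEq] at h2'
  obtain ⟨e1, -⟩ := h2'
  have e1 : p = p₀ := by exact_mod_cast e1
  subst e1
  rw [IsPartialQuotientSucc, ← hv] at ha
  obtain ⟨gp, hs, hgp⟩ := GenContFract.exists_s_b_of_partDen ha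
  have hp : (GenContFract.of v).nums k = p := by
    rw [GenContFract.num_eq_conts_a, GenContFract.nth_cont_eq_succ_nth_contAux, h2]
  have hq : (GenContFract.of v).dens k = q := by
    rw [GenContFract.den_eq_conts_b, GenContFract.nth_cont_eq_succ_nth_contAux, h2]
  have hp' : (GenContFract.of v).nums (k + 1) = p' := by
    rw [GenContFract.num_eq_conts_a, GenContFract.nth_cont_eq_succ_nth_contAux, h6]
  have hq' : (GenContFract.of v).dens (k + 1) = q' := by
    rw [GenContFract.den_eq_conts_b, GenContFract.nth_cont_eq_succ_nth_contAux, h6]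
  have hnt : ¬ (GenContFract.of v).TerminatedAt k := by
    rw [GenContFract.terminatedAt_iff_s_none, hs]
    simp
  have hqpos : (0 : ℝ) < q := by exact_mod_cast h5
  have hqpos' : (0 : ℝ) < q' := by exact_mod_cast h8
  have hrec := GenContFract.contsAux_recurrence hs h1 h2
  rw [h6, GenContFract.Pair.mk.injEq,
    (GenContFract.of_partNum_eq_one_and_exists_int_partDen_eq hs).1, hgp] at hrec
  refine ⟨p, q, p', q', hp, hp', h3.trans h4, h7, ?_, h8, ?_, ?_, ?_⟩
  · have : (A : ℝ) ≤ p := by exact_mod_cast h4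
    linarith [hrec.1]
  · have hdet := SimpContFract.determinant (s := SimpContFract.of v) (n := k) hnt
    change (GenContFract.of v).nums k * (GenContFract.of v).dens (k + 1) -
      (GenContFract.of v).dens k * (GenContFract.of v).nums (k + 1) = _ at hdet
    rw [hp, hq, hp', hq'] at hdet
    intro h
    have h' : (p : ℝ) * q' = q * p' := by exact_mod_cast h
    rw [h', sub_self] at hdet
    exact pow_ne_zero _ (by norm_num) hdet.symm
  · have h := GenContFract.abs_sub_convs_le hnt
    rw [GenContFract.conv_eq_num_div_den, hp, hq, hq'] at h
    have e : (p : ℝ) * n - q * m = -((v - p / q) * (n * q)) := by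
      rw [← hvn]
      field_simp
      ring
    rw [e, abs_neg, abs_mul, abs_of_pos (mul_pos hn' hqpos)]
    calc _ ≤ 1 / ((q : ℝ) * q') * (n * q) * q' := by gcongr
      _ = n := by field_simp
  -- If the expansion stops at `k + 1`, the displacement vanishes; otherwise the next denominator is
  -- at least `q'`.
  · by_cases ht : (GenContFract.of v).TerminatedAt (k + 1)
    · have h := GenContFract.of_correctness_of_terminatedAt ht
      rw [GenContFract.conv_eq_num_div_den, hp', hq', eq_div_iff hqpos'.ne'] at h
      have e : (p' : ℝ) * n - q' * m = 0 := by
        rw [← hvn, ← h]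
        ring
      rw [e, abs_zero, zero_mul]
      exact hn'.le
    · have h := GenContFract.abs_sub_convs_le ht
      have hmono : (GenContFract.of v).dens (k + 1) ≤ (GenContFract.of v).dens (k + 1 + 1) :=
        GenContFract.of_den_mono
      rw [GenContFract.conv_eq_num_div_den, hp', hq'] at h
      rw [hq'] at hmono
      have e : (p' : ℝ) * n - q' * m = -((v - p' / q') * (n * q')) := by
        rw [← hvn]
        field_simp
        ring
      rw [e, abs_neg, abs_mul, abs_of_pos (mul_pos hn' hqpos')]
      have h' : |v - p' / q'| ≤ 1 / ((q' : ℝ) * q') := h.trans (by gcongr)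
      calc _ ≤ 1 / ((q' : ℝ) * q') * (n * q') * q' := by gcongr
        _ = n := by field_simp

/-! ### Choice of the parameters -/

theorem eventually_le_rpow {b : ℝ} (hb : 0 < b) (c : ℝ) :
    ∀ᶠ n : ℕ in Filter.atTop, c ≤ (n : ℝ) ^ b :=
  ((tendsto_rpow_atTop hb).comp tendsto_natCast_atTop_atTop).eventually_ge_atTop c

theorem eventually_mul_rpow_le_exp {b d : ℝ} (hb : 0 < b) (hd : 0 < d) (c s : ℝ) :
    ∀ᶠ n : ℕ in Filter.atTop, c * (n : ℝ) ^ s ≤ Real.exp (d * (n : ℝ) ^ b) := by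
  have h1 := ((tendsto_rpow_mul_exp_neg_mul_atTop_nhds_zero (s / b) d hd).comp
    ((tendsto_rpow_atTop hb).comp tendsto_natCast_atTop_atTop)).const_mul c
  rw [mul_zero] at h1
  filter_upwards [h1.eventually_le_const one_pos] with n hn
  simp only [Function.comp_apply] at hn
  rw [← Real.rpow_mul (Nat.cast_nonneg n), mul_div_cancel₀ s hb.ne', neg_mul, Real.exp_neg,
    ← mul_assoc, ← div_eq_mul_inv, div_le_one (Real.exp_pos _)] at hn
  exact hn

/-- The tail estimate for walls coming from two lattice vectors of controlled size. -/
theorem law_longCycle_le_exp {ε C : ℝ} (hε : 0 < ε) (hC : 1 < C) {n m p q p' q' : ℕ} [NeZero n]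
    [NeZero m] (hn8 : 8 ≤ n) (hmC : (m : ℝ) < C * n) (h43 : 43 ≤ (n : ℝ) ^ (ε / 4))
    (h20 : 20 ≤ (n : ℝ) ^ (3 / 28 * ε))
    (hexp : 106 * C * (n : ℝ) ^ (4 + ε) ≤ Real.exp (1 / 20 * (n : ℝ) ^ (ε / 4)))
    (hp1 : 1 ≤ p) (hp1' : 1 ≤ p') (hdet : (p : ℤ) * q' ≠ q * p')
    (hD : |(p : ℝ) * n - q * m| ≤ (n : ℝ) ^ (2 / 3 + ε / 4))
    (hD' : |(p' : ℝ) * n - q' * m| ≤ (n : ℝ) ^ (2 / 3 + ε / 4))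
    (hτ1 : ((p * n + q * m : ℕ) : ℝ) ≤ 5 * (n : ℝ) ^ (4 / 3 : ℝ))
    (hτ1' : ((p' * n + q' * m : ℕ) : ℝ) ≤ 5 * (n : ℝ) ^ (4 / 3 : ℝ)) :
    (law n m).real (longCycle n m ((n : ℝ) ^ (4 / 3 + ε))) ≤ Real.exp (-(n : ℝ) ^ (ε / 7)) := by
  have hn0 : (0 : ℝ) < n := by positivity
  have hn1 : (1 : ℝ) ≤ n := by exact_mod_cast (by omega : 1 ≤ n)
  have pmono : ∀ {s t : ℝ}, s ≤ t → (n : ℝ) ^ s ≤ (n : ℝ) ^ t := fun h =>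
    Real.rpow_le_rpow_of_exponent_le hn1 h
  have padd : ∀ s t : ℝ, (n : ℝ) ^ s * (n : ℝ) ^ t = (n : ℝ) ^ (s + t) := fun s t =>
    (Real.rpow_add hn0 s t).symm
  have hm0 : (0 : ℝ) ≤ m := Nat.cast_nonneg m
  set w : ℝ := (n : ℝ) ^ (2 / 3 + ε / 4) with hw
  have hw0 : 0 ≤ w := Real.rpow_nonneg hn0.le _
  obtain ⟨R, hR⟩ : ∃ R, R = ⌈w⌉₊ := ⟨_, rfl⟩
  have hRw : w ≤ R := hR ▸ Nat.le_ceil w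
  have hRw' : (R : ℝ) < w + 1 := hR ▸ Nat.ceil_lt_add_one hw0
  have hw2 : 2 ≤ w := by
    have h1 : (8 : ℝ) ≤ n := by exact_mod_cast hn8
    calc (2 : ℝ) ≤ 43 := by norm_num
      _ ≤ (n : ℝ) ^ (ε / 4) := h43
      _ ≤ w := pmono (by linarith)
  obtain ⟨τ, hτ⟩ : ∃ τ, τ = p * n + q * m := ⟨_, rfl⟩
  obtain ⟨τ', hτ'⟩ : ∃ τ', τ' = p' * n + q' * m := ⟨_, rfl⟩
  rw [← hτ] at hτ1
  rw [← hτ'] at hτ1'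
  have hτ0 : 0 < τ := by
    have : 0 < p * n := Nat.mul_pos hp1 (by omega)
    omega
  have hτ0' : 0 < τ' := by
    have : 0 < p' * n := Nat.mul_pos (by omega) (by omega)
    omega
  obtain ⟨B, hB⟩ : ∃ B, B = 4 * (R + 1) ^ 2 := ⟨_, rfl⟩
  obtain ⟨M, hM⟩ : ∃ M, M = τ + τ' + B := ⟨_, rfl⟩
  obtain ⟨J, hJ⟩ : ∃ J, J = ⌊(n : ℝ) ^ (ε / 4)⌋₊ := ⟨_, rfl⟩
  have hz0 : 0 ≤ (n : ℝ) ^ (ε / 4) := Real.rpow_nonneg hn0.le _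
  have hJ1 : (J : ℝ) ≤ (n : ℝ) ^ (ε / 4) := hJ ▸ Nat.floor_le hz0
  have hJ2 : (n : ℝ) ^ (ε / 4) < J + 1 := hJ ▸ Nat.lt_floor_add_one _
  have hw_sq : w ^ 2 = (n : ℝ) ^ (4 / 3 + ε / 2) := by
    rw [sq, hw, padd]
    congr 1
    ring
  have hB1 : (B : ℝ) ≤ 16 * (n : ℝ) ^ (4 / 3 + ε / 2) := by
    rw [hB, ← hw_sq]
    push_cast
    nlinarith
  -- `26 = 5 + 5 + 16`, from `τ`, `τ'` and `B`; one block more of `16` and the final `1` give the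
  -- `43` below.
  have hM1 : (M : ℝ) ≤ 26 * (n : ℝ) ^ (4 / 3 + ε / 2) := by
    have : (n : ℝ) ^ (4 / 3 : ℝ) ≤ (n : ℝ) ^ (4 / 3 + ε / 2) := pmono (by linarith)
    rw [hM]
    push_cast
    linarith
  have hL : ((M + J * B : ℕ) : ℝ) + 1 ≤ (n : ℝ) ^ (4 / 3 + ε) := by
    have h1 : (J : ℝ) * B ≤ 16 * (n : ℝ) ^ (4 / 3 + 3 / 4 * ε) := by
      calc (J : ℝ) * B ≤ (n : ℝ) ^ (ε / 4) * (16 * (n : ℝ) ^ (4 / 3 + ε / 2)) := by gcongr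
        _ = 16 * ((n : ℝ) ^ (ε / 4) * (n : ℝ) ^ (4 / 3 + ε / 2)) := by ring
        _ = 16 * (n : ℝ) ^ (4 / 3 + 3 / 4 * ε) := by
            rw [padd]
            congr 2
            ring
    have h2 : (n : ℝ) ^ (4 / 3 + ε / 2) ≤ (n : ℝ) ^ (4 / 3 + 3 / 4 * ε) := pmono (by linarith)
    have h3 : 1 ≤ (n : ℝ) ^ (4 / 3 + 3 / 4 * ε) := Real.one_le_rpow hn1 (by positivity)
    push_cast
    calc (M : ℝ) + J * B + 1 ≤ 43 * (n : ℝ) ^ (4 / 3 + 3 / 4 * ε) := by linarith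
      _ ≤ (n : ℝ) ^ (ε / 4) * (n : ℝ) ^ (4 / 3 + 3 / 4 * ε) := by gcongr
      _ = (n : ℝ) ^ (4 / 3 + ε) := by
          rw [padd]
          congr 1
          ring
  have hRD : |(p : ℤ) * n - q * m| ≤ R := by
    exact_mod_cast hD.trans hRw
  have hRD' : |(p' : ℤ) * n - q' * m| ≤ R := by
    exact_mod_cast hD'.trans hRw
  rw [hB] at hM hL
  refine (law_longCycle_le_of_lattice hτ hτ' hτ0 hτ0' hdet hM.ge hRD hRD' J hL).trans ?_
  set e : ℝ := Real.exp (-((n : ℝ) ^ (ε / 4) / 10)) with he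
  have hdecay : ∀ t : ℕ, 0 < t → (t : ℝ) ≤ 5 * (n : ℝ) ^ (4 / 3 : ℝ) →
      Real.exp (-((R : ℝ) ^ 2 / (2 * t))) ≤ e := by
    intro t ht htn
    have ht' : (0 : ℝ) < t := by exact_mod_cast ht
    refine Real.exp_le_exp.2 (neg_le_neg ?_)
    rw [le_div_iff₀ (by positivity)]
    calc (n : ℝ) ^ (ε / 4) / 10 * (2 * t)
        ≤ (n : ℝ) ^ (ε / 4) / 10 * (2 * (5 * (n : ℝ) ^ (4 / 3 : ℝ))) := by gcongr
      _ = (n : ℝ) ^ (ε / 4) * (n : ℝ) ^ (4 / 3 : ℝ) := by ring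
      _ ≤ w ^ 2 := by
          rw [padd, hw_sq]
          exact pmono (by linarith)
      _ ≤ (R : ℝ) ^ 2 := by gcongr
  -- The factor `2` pays for the floor in `J`.
  have hhalf : (1 / 2 : ℝ) ^ J ≤ 2 * e := by
    have h1 : Real.exp ((n : ℝ) ^ (ε / 4) / 10) ≤ 2 ^ (J + 1) := by
      have h2 : Real.exp (1 / 10) ≤ 2 := by
        have := Real.exp_bound_div_one_sub_of_interval' (x := 1 / 10) (by norm_num) (by norm_num)
        norm_num at this ⊢
        linarith
      calc Real.exp ((n : ℝ) ^ (ε / 4) / 10) ≤ Real.exp (((J + 1 : ℕ) : ℝ) * (1 / 10)) := by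
            refine Real.exp_le_exp.2 ?_
            push_cast
            linarith
        _ = Real.exp (1 / 10) ^ (J + 1) := Real.exp_nat_mul _ _
        _ ≤ 2 ^ (J + 1) := by gcongr
    rw [he, Real.exp_neg, one_div, inv_pow, ← div_eq_mul_inv, le_div_iff₀ (Real.exp_pos _),
      inv_mul_le_iff₀ (by positivity)]
    rw [pow_succ] at h1
    linarith
  have he0 : 0 < e := Real.exp_pos _
  have hx0 : 1 ≤ (n : ℝ) ^ (4 / 3 + ε / 2) := Real.one_le_rpow hn1 (by positivity)
  calc (n : ℝ) * m * ((1 / 2) ^ J + M * (2 * Real.exp (-((R : ℝ) ^ 2 / (2 * τ)))) +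
        M * (2 * Real.exp (-((R : ℝ) ^ 2 / (2 * τ')))))
      ≤ (n : ℝ) * (C * n) * (2 * e + 26 * (n : ℝ) ^ (4 / 3 + ε / 2) * (2 * e) +
        26 * (n : ℝ) ^ (4 / 3 + ε / 2) * (2 * e)) := by
        have := hdecay τ hτ0 hτ1
        have := hdecay τ' hτ0' hτ1'
        gcongr
    _ ≤ (n : ℝ) * (C * n) * (106 * (n : ℝ) ^ (4 / 3 + ε / 2) * e) := by
        gcongr
        nlinarith
    _ = 106 * C * ((n : ℝ) ^ (2 : ℝ) * (n : ℝ) ^ (4 / 3 + ε / 2)) * e := by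
        rw [Real.rpow_two]
        ring
    _ ≤ 106 * C * (n : ℝ) ^ (4 + ε) * e := by
        rw [padd]
        gcongr ?_ * ?_ * e
        exact pmono (by linarith)
    _ ≤ Real.exp (1 / 20 * (n : ℝ) ^ (ε / 4)) * e := by gcongr
    _ ≤ Real.exp (-(n : ℝ) ^ (ε / 7)) := by
        rw [he, ← Real.exp_add]
        refine Real.exp_le_exp.2 ?_
        -- Half of the decay `n ^ (ε/4) / 10` absorbs the polynomial prefactor; the other half must
        -- beat `n ^ (ε/7)`, and `ε/4 - ε/7 = 3ε/28`.
        have h1 : 20 * (n : ℝ) ^ (ε / 7) ≤ (n : ℝ) ^ (ε / 4) := by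
          calc 20 * (n : ℝ) ^ (ε / 7) ≤ (n : ℝ) ^ (3 / 28 * ε) * (n : ℝ) ^ (ε / 7) := by gcongr
            _ = (n : ℝ) ^ (ε / 4) := by
                rw [padd]
                congr 1
                ring
        linarith

end QuenchedWalk

/-! ### The theorem -/

open QuenchedWalk in
theorem mainTheorem7 (ε : ℝ) (hε : 0 < ε) (C : ℝ) (hC : 1 < C) :
    ∃ N : ℕ, ∀ (n m : ℕ) [NeZero n] [NeZero m], N ≤ n → n < m → (m : ℝ) < C * n →
      ∀ (k l : ℕ) (a b : ℝ), k < l →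
        QuenchedWalk.convNum n m k ≤ (n : ℝ) ^ (1 / 3 - 7 / 48 * ε) →
        (n : ℝ) ^ (1 / 3 - 7 / 48 * ε) < QuenchedWalk.convNum n m (k + 1) →
        QuenchedWalk.convNum n m l ≤ (n : ℝ) ^ (1 / 3 + 47 / 48 * ε) →
        (n : ℝ) ^ (1 / 3 + 47 / 48 * ε) < QuenchedWalk.convNum n m (l + 1) →
        QuenchedWalk.IsPartialQuotientSucc n m k a →
        QuenchedWalk.IsPartialQuotientSucc n m l b →
        max a b < (n : ℝ) ^ (5 / 48 * ε) →
        (QuenchedWalk.law n m).real (QuenchedWalk.longCycle n m ((n : ℝ) ^ (4 / 3 + ε)))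
          ≤ Real.exp (-(n : ℝ) ^ (ε / 7)) := by
  obtain ⟨N, hN⟩ := Filter.eventually_atTop.1
    ((Filter.eventually_ge_atTop 8).and <|
      (eventually_le_rpow (show 0 < 5 / 48 * ε by positivity) (2 * C)).and <|
      (eventually_le_rpow (show 0 < ε / 4 by positivity) 43).and <|
      (eventually_le_rpow (show 0 < 3 / 28 * ε by positivity) 20).and
      (eventually_mul_rpow_le_exp (show 0 < ε / 4 by positivity) (show (0 : ℝ) < 1 / 20 by norm_num)
        (106 * C) (4 + ε)))
  refine ⟨N, fun n m _ _ hn hnm hmC k l a b _ hk hk1 _ _ ha _ hab => ?_⟩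
  obtain ⟨hn8, h5, h43, h20, hexp⟩ := hN n hn
  have hn0 : (0 : ℝ) < n := by positivity
  have hn1 : (1 : ℝ) ≤ n := by exact_mod_cast (by omega : 1 ≤ n)
  have pmono : ∀ {s t : ℝ}, s ≤ t → (n : ℝ) ^ s ≤ (n : ℝ) ^ t := fun h =>
    Real.rpow_le_rpow_of_exponent_le hn1 h
  have padd : ∀ s t : ℝ, (n : ℝ) ^ s * (n : ℝ) ^ t = (n : ℝ) ^ (s + t) := fun s t =>
    (Real.rpow_add hn0 s t).symm
  have hm0 : (0 : ℝ) ≤ m := Nat.cast_nonneg m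
  obtain ⟨p, q, p', q', hp, hp', hp1, hpp, hpa, hq', hdet, hD, hD'⟩ :=
    exists_convergents (by omega) hnm.le ha
  rw [hp] at hk
  rw [hp'] at hk1
  set y : ℝ := (n : ℝ) ^ (1 / 3 - 7 / 48 * ε) with hy
  have hp1R : (1 : ℝ) ≤ p := by exact_mod_cast hp1
  have hq1R : (1 : ℝ) ≤ q' := by exact_mod_cast hq'
  have hppR : (p : ℝ) ≤ p' := by exact_mod_cast hpp
  have hy1 : 1 ≤ y := hp1R.trans hk
  have hp2 : (2 : ℝ) ≤ p' := by
    have : (1 : ℝ) < p' := hy1.trans_lt hk1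
    exact_mod_cast this
  -- the numerators are at most of order `n ^ (1 / 3)`
  have ha' : a < (n : ℝ) ^ (5 / 48 * ε) := (le_max_left a b).trans_lt hab
  have hp3 : (p' : ℝ) ≤ 2 * (n : ℝ) ^ (1 / 3 : ℝ) := by
    have h1 : 1 ≤ (n : ℝ) ^ (5 / 48 * ε) := by linarith
    calc (p' : ℝ) ≤ (a + 1) * p := hpa
      _ ≤ (2 * (n : ℝ) ^ (5 / 48 * ε)) * y := by
          have : a + 1 ≤ 2 * (n : ℝ) ^ (5 / 48 * ε) := by linarith
          gcongr
      _ = 2 * (n : ℝ) ^ (5 / 48 * ε + (1 / 3 - 7 / 48 * ε)) := by rw [hy, mul_assoc, padd]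
      _ ≤ 2 * (n : ℝ) ^ (1 / 3 : ℝ) := by
          gcongr 2 * ?_
          exact pmono (by linarith)
  -- the displacements of the two lattice vectors
  have hqC : y ≤ 2 * C * q' := by
    have h1 : |(p' : ℝ) * n - q' * m| ≤ n :=
      (le_mul_of_one_le_right (abs_nonneg _) hq1R).trans hD'
    have h2 : (p' : ℝ) * n ≤ q' * m + n := by linarith [le_abs_self ((p' : ℝ) * n - q' * m)]
    have h3 : (q' : ℝ) * m ≤ q' * (C * n) := by gcongr
    have h4 : (p' : ℝ) * n ≤ (q' * C + 1) * n := by linarith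
    have h5 : (p' : ℝ) ≤ q' * C + 1 := le_of_mul_le_mul_right h4 hn0
    linarith
  -- `|D| ≤ n / q' ≤ 2 C n / y`, with `2 C` absorbed in `n ^ (5ε/48)`; the exponents `5/48 + 7/48`
  -- add up to `1/4`.
  have hdisp : ∀ D : ℝ, |D| * q' ≤ n → |D| ≤ (n : ℝ) ^ (2 / 3 + ε / 4) := by
    intro D hD
    have h1 : |D| * y ≤ (n : ℝ) ^ (2 / 3 + ε / 4) * y := by
      calc |D| * y ≤ |D| * (2 * C * q') := by gcongr
        _ = 2 * C * (|D| * q') := by ring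
        _ ≤ (n : ℝ) ^ (5 / 48 * ε) * n := by gcongr
        _ = (n : ℝ) ^ (5 / 48 * ε) * (n : ℝ) ^ (1 : ℝ) := by rw [Real.rpow_one]
        _ = (n : ℝ) ^ (2 / 3 + ε / 4) * y := by
            rw [hy, padd, padd]
            congr 1
            ring
    exact le_of_mul_le_mul_right h1 (by linarith)
  -- `P n + Q m ≤ 2 P n + |P n - Q m|`, whence `5 = 2 * 2 + 1`.
  have hτle : ∀ P Q : ℕ, (P : ℝ) ≤ p' → |(P : ℝ) * n - Q * m| * q' ≤ n →
      ((P * n + Q * m : ℕ) : ℝ) ≤ 5 * (n : ℝ) ^ (4 / 3 : ℝ) := by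
    intro P Q hP hPQ
    have h1 : |(P : ℝ) * n - Q * m| ≤ n :=
      (le_mul_of_one_le_right (abs_nonneg _) hq1R).trans hPQ
    have h2 := neg_abs_le ((P : ℝ) * n - Q * m)
    have h3 : (n : ℝ) ^ (1 / 3 : ℝ) * n = (n : ℝ) ^ (4 / 3 : ℝ) := by
      nth_rewrite 2 [← Real.rpow_one (n : ℝ)]
      rw [padd]
      norm_num
    have h4 : (n : ℝ) ≤ (n : ℝ) ^ (4 / 3 : ℝ) := by
      nth_rewrite 1 [← Real.rpow_one (n : ℝ)]
      exact pmono (by norm_num)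
    have h5 : (P : ℝ) * n ≤ 2 * (n : ℝ) ^ (1 / 3 : ℝ) * n := by
      gcongr
      exact hP.trans hp3
    push_cast
    linarith
  exact law_longCycle_le_exp hε hC hn8 hmC h43 h20 hexp hp1 (hp1.trans hpp) hdet (hdisp _ hD)
    (hdisp _ hD') (hτle p q hppR hD) (hτle p' q' le_rfl hD')
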